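/- Let $\mathcal R=\langle G,Q,P,F \mid [G,Q]=[Q,P]=[P,F]=1\rangle$ be the right-angled Artin group whose defining graph is the path $G - Q - P - F$ with four vertices. Let $\mathbb F$ be a field with prime subfield $\mathbb P$ (for example $\mathbb F=\mathbb C$, or $\mathbb F$ an algebraically closed field of characteristic $p>0$ and of infinite transcendence degree over $\mathbb P=\mathbb F_p$). Let $a,b,c,d,\alpha,\beta,\gamma,\delta,\lambda\in\mathbb F$ with $ad-bc\neq 0$, $\alpha\delta-\beta\gamma\neq 0$ and $\lambda\neq 0$, and consider the following matrices in $GL(3,\mathbb F)$: $$G_0=\begin{pmatrix}a&b&0\\c&d&0\\0&0&1\end{pmatrix},\quad Q_0=\begin{pmatrix}\lambda&0&0\\0&\lambda&0\\0&0&\lambda^{-1}\end{pmatrix},\quad P_0=\begin{pmatrix}\lambda&0&0\\0&\lambda^{-1}&0\\0&0&\lambda\end{pmatrix},\quad F_0=\begin{pmatrix}\alpha&0&\beta\\0&1&0\\\gamma&0&\delta\end{pmatrix}.$$ Suppose that (1) for every integer $n\neq 0$, both off-diagonal entries of $\begin{pmatrix}\alpha&\beta\\\gamma&\delta\end{pmatrix}^n$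 are nonzero; (2) the subgroup of $GL(2,\mathbb F)$ generated by $\begin{pmatrix}a&b\\c&d\end{pmatrix}$ and $\begin{pmatrix}\lambda&0\\0&\lambda^{-1}\end{pmatrix}$ is a non-abelian free group, and its only element with top left entry equal to $1$ is the identity $I_2$. Let $\phi\in\mathbb F$ be transcendental over the field $\mathbb P(a,b,c,d,\alpha,\beta,\gamma,\delta,\lambda)$ and let $D=\mathrm{diag}(\phi,\phi^2,\phi^3)$. Then $F_0P_0F_0^{-1}=P_0=DP_0D^{-1}$, and the assignment $$G\mapsto F_0G_0F_0^{-1},\qquad Q\mapsto F_0Q_0F_0^{-1},\qquad P\mapsto DP_0D^{-1}=P_0,\qquad F\mapsto DF_0D^{-1}$$ extends to an injective homomorphism $\mathcal R\to GL(3,\mathbb F)$, that is, to a faithful representation of $\mathcal R$. -/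

import Mathlib

noncomputable section

/-- The right angled Artin group of a simple graph: one generator for each vertex, and the
commutators of the pairs of adjacent vertices as relators. -/
abbrev RAAG {V : Type*} (Γ : SimpleGraph V) : Type _ :=
  PresentedGroup {r : FreeGroup V | ∃ u v : V, Γ.Adj u v ∧
    r = FreeGroup.of u * FreeGroup.of v * (FreeGroup.of u)⁻¹ * (FreeGroup.of v)⁻¹}

/-- The generator of the right angled Artin group that belongs to the vertex `v`. -/
def RAAG.gen {V : Type*} (Γ : SimpleGraph V) (v : V) : RAAG Γ :=
  PresentedGroup.of v

/-- The invertible matrix with rows `(a, b)` and `(c, d)`. -/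
def gl2 {F : Type*} [Field F] (a b c d : F) (h : a * d - b * c ≠ 0) : GL (Fin 2) F :=
  Matrix.GeneralLinearGroup.mkOfDetNeZero !![a, b; c, d] (by
    rw [Matrix.det_fin_two_of]; exact h)

/-- The invertible diagonal matrix with diagonal entries `lam` and `lam⁻¹`. -/
def gl2Diag {F : Type*} [Field F] (lam : F) (h : lam ≠ 0) : GL (Fin 2) F :=
  gl2 lam 0 0 lam⁻¹ (by simp [h])

/-- A group is a non-abelian free group. -/
def IsNonabelianFree (H : Type*) [Group H] : Prop :=
  IsFreeGroup H ∧ ∃ x y : H, x * y ≠ y * x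

def matG₀ {F : Type*} [Field F] (a b c d : F) : Matrix (Fin 3) (Fin 3) F :=
  !![a, b, 0; c, d, 0; 0, 0, 1]

def matQ₀ {F : Type*} [Field F] (lam : F) : Matrix (Fin 3) (Fin 3) F :=
  !![lam, 0, 0; 0, lam, 0; 0, 0, lam⁻¹]

def matP₀ {F : Type*} [Field F] (lam : F) : Matrix (Fin 3) (Fin 3) F :=
  !![lam, 0, 0; 0, lam⁻¹, 0; 0, 0, lam]

def matF₀ {F : Type*} [Field F] (α β γ δ : F) : Matrix (Fin 3) (Fin 3) F :=
  !![α, 0, β; 0, 1, 0; γ, 0, δ]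

def matD {F : Type*} [Field F] (φ : F) : Matrix (Fin 3) (Fin 3) F :=
  !![φ, 0, 0; 0, φ ^ 2, 0; 0, 0, φ ^ 3]

end

/-!
Write `A = ⟨G, Q, P⟩ = ⟨Q⟩ × ⟨G, P⟩`. As `F` commutes with `P`, every element of the group lies in
`A` or has the form `a₀ F ^ n₁ a₁ ⋯ F ^ nₖ aₖ` with `k ≥ 1`, `nᵢ ≠ 0`, `aᵢ ∈ A`, and `aᵢ ∉ ⟨P⟩` for
`0 < i < k`.

The images of the elements of `A` have entries in `K = ℙ(a, b, c, d, α, β, γ, δ, λ)`, whereas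
conjugation by `D` turns the image of `F ^ n` into a Laurent polynomial in `φ` whose terms of
extreme degree are nonzero multiples of the matrix units `E₁₃` and `E₃₁`. If `α ≠ 0`, the image of
every `a ∈ A` outside `⟨P⟩` has a nonzero `(1, 3)` entry, and if `δ ≠ 0` a nonzero `(3, 1)` entry:
up to a nonzero factor this entry is `x - y`, where `x` and `y` are the first and the last diagonal
entry of the image of `a` before conjugation by `F₀`, and `x = y` forces a nontrivial element of the
free group of the second hypothesis to have top left entry `1`, unless `a ∈ ⟨P⟩`. One of the two
cases occurs because `F₀ ^ 2` has a nonzero `(1, 3)` entry. Expanding in powers of `φ⁻¹` or of `φ`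
accordingly, the extreme terms of the factors do not cancel, so the product has a nonconstant term
in `φ` and is not the identity.

The subgroup of `GL(2)` in the second hypothesis is only known to be free, and it is free on the two
given matrices because free groups are Hopfian.
-/

section FreeGroups

theorem finite_monoidHom_of_fg (G T : Type*) [Group G] [Group.FG G] [Monoid T] [Finite T] :
    Finite (G →* T) := by
  obtain ⟨S, hS⟩ := Group.fg_def.1 ‹Group.FG G›
  refine .of_injective (fun (h : G →* T) (s : S) => h s) fun h₁ h₂ h => ?_
  exact MonoidHom.eq_of_eqOn_dense hS fun s hs => congrFun h ⟨s, hs⟩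

/-- A nontrivial element `w` of the kernel survives in a finite quotient `q`, and `q` factors
through `f` because precomposition with `f` is injective on the finite set of homomorphisms. -/
theorem injective_of_surjective_of_residuallyFinite {G : Type*} [Group G] [Group.FG G]
    [Group.ResiduallyFinite G] (f : G →* G) (hf : Function.Surjective f) :
    Function.Injective f := by
  refine (injective_iff_map_eq_one f).2 fun w hw => by_contra fun hne => ?_
  obtain ⟨N, hN⟩ := Group.exists_finiteIndexNormalSubgroup_notMem w hne
  let q : G →* G ⧸ N.toSubgroup := QuotientGroup.mk' _
  have := finite_monoidHom_of_fg G (G ⧸ N.toSubgroup)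
  have hprecomp : Function.Injective fun h : G →* G ⧸ N.toSubgroup => h.comp f :=
    fun _ _ => (MonoidHom.cancel_right hf).1
  obtain ⟨h, hh : h.comp f = q⟩ := Finite.surjective_of_injective hprecomp q
  have hqw : q w = 1 := by rw [← hh, MonoidHom.comp_apply, hw, map_one]
  exact hN ((QuotientGroup.eq_one_iff w).1 hqw)

theorem exists_perm_extending_mul_left {G : Type*} [Group G] (S : Set G) [Finite S] (g : G) :
    ∃ σ : Equiv.Perm S, ∀ s t : S, (t : G) = g * s → σ s = t := by
  obtain ⟨σ, hσ⟩ := Equiv.Perm.exists_extending_pair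
    (fun p : {s : S // g * s ∈ S} => p.1) (fun p => ⟨g * p.1, p.2⟩) Subtype.val_injective
    fun p q h => Subtype.ext (Subtype.ext (mul_left_cancel (Subtype.ext_iff.1 h)))
  refine ⟨σ, fun s t h => ?_⟩
  exact (hσ ⟨s, h ▸ t.2⟩).trans (Subtype.ext h.symm)

theorem coe_lift_mk_apply_of_forall_suffix {ι G : Type*} [Group G] {S : Set G} {g : ι → G}
    {σ : ι → Equiv.Perm S} (hσ : ∀ i (s t : S), (t : G) = g i * s → σ i s = t) (s : S)
    (L : List (ι × Bool)) (hL : ∀ L', L' <:+ L → FreeGroup.lift g (FreeGroup.mk L') * s ∈ S) :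
    (FreeGroup.lift σ (FreeGroup.mk L) s : G) = FreeGroup.lift g (FreeGroup.mk L) * s := by
  induction L with
  | nil => simp [← FreeGroup.one_eq_mk]
  | cons x L ih =>
    obtain ⟨i, b⟩ := x
    have hmem := hL _ List.suffix_rfl
    have htail : FreeGroup.lift σ (FreeGroup.mk L) s =
        ⟨_, hL L (List.suffix_cons _ L)⟩ :=
      Subtype.ext (ih fun L' h => hL L' (h.trans (List.suffix_cons _ L)))
    simp only [FreeGroup.lift_mk, List.map_cons, List.prod_cons, Equiv.Perm.mul_apply]
      at hmem htail ⊢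
    rw [htail]
    cases b with
    | true =>
      exact congrArg Subtype.val (hσ i _ ⟨_, hmem⟩ (mul_assoc _ _ _))
    | false =>
      refine congrArg Subtype.val (Equiv.Perm.inv_eq_iff_eq.2 (hσ i ⟨_, hmem⟩ _ ?_).symm)
      simp only [cond_false, mul_assoc, mul_inv_cancel_left]

/-- The generators act by left multiplication on the finite set of suffixes of a word, wherever
the product is again a suffix; any extensions to permutations detect the word. -/
instance residuallyFinite_freeGroup (ι : Type*) : Group.ResiduallyFinite (FreeGroup ι) := by
  refine Group.residuallyFinite_of_forall_exists_finite_monoidHom fun w hw => ?_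
  obtain ⟨L, rfl⟩ : ∃ L, FreeGroup.mk L = w := Quot.exists_rep w
  let S : Set (FreeGroup ι) := FreeGroup.mk '' {L' | L' ∈ L.tails}
  have : Finite S := (L.tails.finite_toSet.image _).to_subtype
  have hmem {L'} (h : L' <:+ L) : FreeGroup.mk L' ∈ S := ⟨L', by simpa using h, rfl⟩
  choose σ hσ using fun i => exists_perm_extending_mul_left S (FreeGroup.of i)
  refine ⟨Equiv.Perm S, inferInstance, inferInstance, FreeGroup.lift σ, fun h => hw ?_⟩
  have hact := coe_lift_mk_apply_of_forall_suffix hσ ⟨1, hmem List.nil_suffix⟩ L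
    fun L' h => by simpa only [FreeGroup.lift_of_eq_id, MonoidHom.id_apply, mul_one] using hmem h
  rw [h, FreeGroup.lift_of_eq_id, MonoidHom.id_apply, mul_one] at hact
  exact hact.symm

/-- Retracting `H` onto a free factor of rank `#α` turns `f` into a surjective endomorphism of
`FreeGroup α`. -/
theorem injective_of_surjective_of_freeGroupBasis {α ι H : Type*} [Finite α] [Group H]
    (B : FreeGroupBasis ι H) (e : α ↪ ι) (f : FreeGroup α →* H) (hf : Function.Surjective f) :
    Function.Injective f := by
  let r : H →* FreeGroup α := B.lift (Function.extend e FreeGroup.of 1)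
  have hr : Function.Surjective r := by
    have hsec : r.comp (FreeGroup.lift (B ∘ e)) = MonoidHom.id _ :=
      FreeGroup.ext_hom _ _ fun i => by simp [r, e.injective.extend_apply]
    exact fun w => ⟨_, DFunLike.congr_fun hsec w⟩
  have hrf := injective_of_surjective_of_residuallyFinite (r.comp f) (hr.comp hf)
  exact Function.Injective.of_comp (f := r) hrf

theorem nontrivial_of_freeGroupBasis_of_mul_ne {ι H : Type*} [Group H] (B : FreeGroupBasis ι H)
    {x y : H} (hxy : x * y ≠ y * x) : Nontrivial ι := by
  refine not_subsingleton_iff_nontrivial.1 fun _ => hxy (B.repr.injective ?_)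
  rw [map_mul, map_mul]
  rcases isEmpty_or_nonempty ι with _ | ⟨⟨i⟩⟩
  · exact Subsingleton.elim _ _
  · have := uniqueOfSubsingleton i
    exact FreeGroup.mulEquivIntOfUnique.injective (by simp only [map_mul, mul_comm])

theorem range_freeGroup_lift_pair {G : Type*} [Group G] (g h : G) :
    (FreeGroup.lift ![g, h]).range = Subgroup.closure {g, h} := by
  rw [FreeGroup.range_lift_eq_closure, Matrix.range_cons_cons_empty]

theorem IsNonabelianFree.lift_injective {G : Type*} [Group G] {g h : G}
    (hfree : IsNonabelianFree (Subgroup.closure {g, h})) :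
    Function.Injective (FreeGroup.lift ![g, h]) := by
  rw [← range_freeGroup_lift_pair] at hfree
  obtain ⟨⟨⟨ι, ⟨B⟩⟩⟩, x, y, hxy⟩ := hfree
  have := nontrivial_of_freeGroupBasis_of_mul_ne B hxy
  obtain ⟨i, j, hij⟩ := exists_pair_ne ι
  have he : Function.Injective ![i, j] := by simpa using hij
  exact MonoidHom.rangeRestrict_injective_iff.1 <| injective_of_surjective_of_freeGroupBasis B
    ⟨_, he⟩ _ (FreeGroup.lift ![g, h]).rangeRestrict_surjective

/-- The sum of the exponents of the generator `i` in a word. -/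
def exponentSum {ι : Type*} [DecidableEq ι] (i : ι) : FreeGroup ι →* Multiplicative ℤ :=
  FreeGroup.lift (Pi.mulSingle i (Multiplicative.ofAdd 1))

theorem exponentSum_of_zpow {ι : Type*} [DecidableEq ι] (i : ι) (n : ℤ) :
    exponentSum i (FreeGroup.of i ^ n) = Multiplicative.ofAdd n := by
  simp [exponentSum, ← ofAdd_zsmul]

theorem commute_freeGroup_lift {ι G : Type*} [Group G] {x : G} {t : ι → G}
    (h : ∀ i, Commute x (t i)) (w : FreeGroup ι) : Commute x (FreeGroup.lift t w) := by
  have hrange : (FreeGroup.lift t).range ≤ Subgroup.centralizer {x} :=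
    FreeGroup.range_lift_le (by
      rintro _ ⟨i, rfl⟩
      exact Subgroup.mem_centralizer_singleton_iff.2 (h i).symm)
  exact (Subgroup.mem_centralizer_singleton_iff.1 (hrange ⟨w, rfl⟩)).symm

end FreeGroups

namespace RAAG

variable {V H : Type*} [Group H] {Γ : SimpleGraph V}

theorem commute_gen {u v : V} (h : Γ.Adj u v) : Commute (gen Γ u) (gen Γ v) :=
  commutatorElement_eq_one_iff_commute.1 (PresentedGroup.one_of_mem ⟨u, v, h, rfl⟩)

theorem closure_range_gen (Γ : SimpleGraph V) : Subgroup.closure (Set.range (gen Γ)) = ⊤ :=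
  PresentedGroup.closure_range_of _

/-- The homomorphism from a right angled Artin group with prescribed values on the vertices. -/
def lift (t : V → H) (ht : ∀ u v, Γ.Adj u v → Commute (t u) (t v)) : RAAG Γ →* H :=
  PresentedGroup.toGroup (f := t) <| by
    rintro r ⟨u, v, h, rfl⟩
    simpa only [map_mul, map_inv, FreeGroup.lift_apply_of, commutatorElement_def] using
      commutatorElement_eq_one_iff_commute.2 (ht u v h)

theorem lift_gen (t : V → H) (ht : ∀ u v, Γ.Adj u v → Commute (t u) (t v)) (v : V) :
    lift t ht (gen Γ v) = t v :=
  PresentedGroup.toGroup.of _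

end RAAG

theorem commute_of_pathGraph_adj {n : ℕ} {H : Type*} [Group H] {t : Fin (n + 1) → H}
    (ht : ∀ i : Fin n, Commute (t i.castSucc) (t i.succ)) {u v : Fin (n + 1)}
    (h : (SimpleGraph.pathGraph (n + 1)).Adj u v) : Commute (t u) (t v) := by
  wlog huv : u ≤ v generalizing u v
  · exact (this h.symm (le_of_not_ge huv)).symm
  have hlt := huv.lt_of_ne h.ne
  have hval : (u : ℕ) + 1 = v := by
    rw [SimpleGraph.pathGraph_adj] at h
    omega
  obtain ⟨i, rfl⟩ := Fin.exists_castSucc_eq.2 (Fin.ne_last_of_lt hlt)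
  obtain rfl : i.succ = v := Fin.ext hval
  exact ht i

section AlternatingProducts

variable {R : Type*} [Group R] {A C : Subgroup R} {f : R}

/-- The products `f ^ n₁ * a₁ * f ^ n₂ * a₂ * ⋯ * f ^ nₖ * aₖ` with `k ≥ 1`, nonzero exponents and
`aᵢ ∈ A`, where only `aₖ` is allowed to lie in `C`. -/
inductive AlternatingProduct (A C : Subgroup R) (f : R) : R → Prop
  | base (n : ℤ) (a : R) : n ≠ 0 → a ∈ A → AlternatingProduct A C f (f ^ n * a)
  | step (n : ℤ) (a x : R) : n ≠ 0 → a ∈ A → a ∉ C → AlternatingProduct A C f x →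
      AlternatingProduct A C f (f ^ n * a * x)

/-- `x` lies in `A`, or it is an alternating product preceded by an element of `A`. When `f`
generates `R` together with `A` and commutes with `C`, every element has such a form. -/
def HasAlternatingForm (A C : Subgroup R) (f x : R) : Prop :=
  x ∈ A ∨ ∃ a ∈ A, ∃ y, AlternatingProduct A C f y ∧ x = a * y

theorem AlternatingProduct.hasAlternatingForm {x : R} (hx : AlternatingProduct A C f x) :
    HasAlternatingForm A C f x :=
  .inr ⟨1, one_mem A, x, hx, (one_mul x).symm⟩

theorem HasAlternatingForm.mul_left {a x : R} (ha : a ∈ A) (hx : HasAlternatingForm A C f x) :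
    HasAlternatingForm A C f (a * x) := by
  rcases hx with hx | ⟨b, hb, y, hy, rfl⟩
  · exact .inl (mul_mem ha hx)
  · exact .inr ⟨a * b, mul_mem ha hb, y, hy, (mul_assoc a b y).symm⟩

theorem AlternatingProduct.zpow_mul {y : R} (hy : AlternatingProduct A C f y) (m : ℤ) :
    HasAlternatingForm A C f (f ^ m * y) := by
  rcases hy with ⟨n, a, -, ha⟩ | ⟨n, a, z, -, ha, haC, hz⟩
  · rw [← mul_assoc, ← zpow_add]
    rcases eq_or_ne (m + n) 0 with h | h
    · rw [h, zpow_zero, one_mul]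
      exact .inl ha
    · exact (base _ a h ha).hasAlternatingForm
  · rw [← mul_assoc, ← mul_assoc, ← zpow_add]
    rcases eq_or_ne (m + n) 0 with h | h
    · rw [h, zpow_zero, one_mul]
      exact .inr ⟨a, ha, z, hz, rfl⟩
    · exact (step _ a z h ha haC hz).hasAlternatingForm

theorem HasAlternatingForm.zpow_mul (hC : ∀ c ∈ C, Commute f c) {x : R}
    (hx : HasAlternatingForm A C f x) (m : ℤ) : HasAlternatingForm A C f (f ^ m * x) := by
  rcases eq_or_ne m 0 with rfl | hm
  · rwa [zpow_zero, one_mul]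
  rcases hx with hx | ⟨a, ha, y, hy, rfl⟩
  · exact (AlternatingProduct.base m x hm hx).hasAlternatingForm
  by_cases haC : a ∈ C
  · rw [← mul_assoc, ((hC a haC).zpow_left m).eq, mul_assoc]
    exact (hy.zpow_mul m).mul_left ha
  · rw [← mul_assoc]
    exact (AlternatingProduct.step m a y hm ha haC hy).hasAlternatingForm

theorem hasAlternatingForm_of_closure_eq_top (hC : ∀ c ∈ C, Commute f c)
    (htop : Subgroup.closure (insert f (A : Set R)) = ⊤) (x : R) : HasAlternatingForm A C f x := by
  have hx : x ∈ Subgroup.closure (insert f (A : Set R)) := htop ▸ Subgroup.mem_top x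
  induction hx using Subgroup.closure_induction_left with
  | one => exact .inl (one_mem A)
  | mul_left s hs y _ ih =>
    rcases hs with rfl | hs
    · simpa only [zpow_one] using ih.zpow_mul hC 1
    · exact ih.mul_left hs
  | inv_mul_cancel s hs y _ ih =>
    rcases hs with rfl | hs
    · simpa only [zpow_neg_one] using ih.zpow_mul hC (-1)
    · exact ih.mul_left (inv_mem hs)

end AlternatingProducts

section LeadingTerms

open Polynomial

variable {K L n : Type*} [CommRing K] [CommRing L] [Algebra K L]

/-- `ψ ^ k • M` is a polynomial in `ψ` over `K` with constant coefficient `M₀`; that is, `M` is a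
Laurent polynomial in `ψ⁻¹` with top degree `k` and leading coefficient `M₀`, if `M₀ ≠ 0`. -/
def HasLeadingTerm (ψ : L) (k : ℕ) (M : Matrix n n L) (M₀ : Matrix n n K) : Prop :=
  ∃ B : Matrix n n K[X], ψ ^ k • M = B.map (aeval ψ) ∧ B.map constantCoeff = M₀

theorem hasLeadingTerm_map (ψ : L) (M : Matrix n n K) :
    HasLeadingTerm ψ 0 (M.map (algebraMap K L)) M :=
  ⟨M.map C, by ext; simp, by ext; simp⟩

theorem HasLeadingTerm.mul [Fintype n] {ψ : L} {k l : ℕ} {M N : Matrix n n L} {M₀ N₀ : Matrix n n K}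
    (hM : HasLeadingTerm ψ k M M₀) (hN : HasLeadingTerm ψ l N N₀) :
    HasLeadingTerm ψ (k + l) (M * N) (M₀ * N₀) := by
  obtain ⟨B, hB, rfl⟩ := hM
  obtain ⟨B', hB', rfl⟩ := hN
  refine ⟨B * B', ?_, Matrix.map_mul⟩
  rw [Matrix.map_mul, ← hB, ← hB', smul_mul_smul_comm, pow_add]

theorem HasLeadingTerm.eq_zero_of_map {ψ : L} (hψ : Transcendental K ψ) {k : ℕ} (hk : k ≠ 0)
    {M M₀ : Matrix n n K} (h : HasLeadingTerm ψ k (M.map (algebraMap K L)) M₀) : M₀ = 0 := by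
  obtain ⟨B, hB, rfl⟩ := h
  ext p q
  have hpq : B p q = C (M p q) * X ^ k := by
    apply transcendental_iff_injective.1 hψ
    rw [map_mul, aeval_C, map_pow, aeval_X, mul_comm]
    exact (congrFun₂ hB p q).symm
  simp [hpq, hk.symm]

variable {R : Type*} [Group R] {A C : Subgroup R} {f : R} [Fintype n] [DecidableEq n]
  [NoZeroDivisors K]

/-- The matrix unit `single i j` picks out the entry `g j i` of each inner factor, so leading terms
do not cancel. -/
theorem AlternatingProduct.exists_hasLeadingTerm {ψ : L} {ρ : R →* GL n L} {i j : n} {e : ℕ}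
    (he : e ≠ 0)
    (hA : ∀ a ∈ A, ∃ g : GL n K,
      Matrix.GeneralLinearGroup.map (algebraMap K L) g = ρ a ∧ (a ∉ C → g j i ≠ 0))
    (hf : ∀ m : ℤ, m ≠ 0 → ∃ c : K, c ≠ 0 ∧
      HasLeadingTerm ψ e (ρ (f ^ m) : Matrix n n L) (Matrix.single i j c))
    {x : R} (hx : AlternatingProduct A C f x) :
    ∃ k ≠ 0, ∃ c : K, c ≠ 0 ∧ ∃ g : GL n K,
      HasLeadingTerm ψ k (ρ x : Matrix n n L) (Matrix.single i j c * (g : Matrix n n K)) := by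
  induction hx with
  | base m a hm ha =>
    obtain ⟨c, hc, hlead⟩ := hf m hm
    obtain ⟨g, hg, -⟩ := hA a ha
    refine ⟨e, he, c, hc, g, ?_⟩
    rw [map_mul, ← hg]
    exact hlead.mul (hasLeadingTerm_map ψ _)
  | step m a y hm ha haC _ ih =>
    obtain ⟨c, hc, hlead⟩ := hf m hm
    obtain ⟨g, hg, hne⟩ := hA a ha
    obtain ⟨k, -, c', hc', g', hlead'⟩ := ih
    refine ⟨e + k, by omega, c * g j i * c', mul_ne_zero (mul_ne_zero hc (hne haC)) hc', g', ?_⟩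
    rw [map_mul, map_mul, ← hg, ← Matrix.single_mul_mul_single, mul_assoc _ _ (g' : Matrix n n K)]
    exact (hlead.mul (hasLeadingTerm_map ψ _)).mul hlead'

theorem injective_of_hasLeadingTerm {ψ : L} (hψ : Transcendental K ψ) {ρ : R →* GL n L} {i j : n}
    (hij : i ≠ j) {e : ℕ} (he : e ≠ 0) (hform : ∀ x, HasAlternatingForm A C f x)
    (hC : ∀ c ∈ C, ρ c = 1 → c = 1)
    (hA : ∀ a ∈ A, ∃ g : GL n K,
      Matrix.GeneralLinearGroup.map (algebraMap K L) g = ρ a ∧ (a ∉ C → g j i ≠ 0))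
    (hf : ∀ m : ℤ, m ≠ 0 → ∃ c : K, c ≠ 0 ∧
      HasLeadingTerm ψ e (ρ (f ^ m) : Matrix n n L) (Matrix.single i j c)) :
    Function.Injective ρ := by
  refine (injective_iff_map_eq_one ρ).2 fun x hx => ?_
  rcases hform x with hxA | ⟨a, ha, y, hy, rfl⟩
  · refine hC x (by_contra fun hxC => ?_) hx
    obtain ⟨g, hg, hne⟩ := hA x hxA
    have hinj : Function.Injective (algebraMap K L) := by
      simpa [Function.comp_def] using (transcendental_iff_injective.1 hψ).comp C_injective
    refine hne hxC (hinj ?_)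
    rw [← Matrix.GeneralLinearGroup.map_apply, hg, hx, map_zero]
    exact Matrix.one_apply_ne hij.symm
  · obtain ⟨k, hk, c, hc, g, hlead⟩ := hy.exists_hasLeadingTerm he hA hf
    obtain ⟨v, hv, -⟩ := hA a⁻¹ (inv_mem ha)
    have hy : ρ y = Matrix.GeneralLinearGroup.map (algebraMap K L) v := by
      rw [hv, map_inv, eq_inv_iff_mul_eq_one, mul_eq_one_comm, ← map_mul, hx]
    rw [hy] at hlead
    have hzero : Matrix.single i j c = 0 := g.isUnit.mul_left_eq_zero.1 (hlead.eq_zero_of_map hψ hk)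
    exact absurd (by simpa using congrFun₂ hzero i j) hc

end LeadingTerms

section BlockMatrices

variable {R S : Type*} [CommRing R] [CommRing S]

/-- The matrices with a block of size two in the rows and columns `0, 1` and a unit in the last
entry, such as `G₀`, `Q₀` and `P₀`. -/
def upperBlockGL : GL (Fin 2) R × Rˣ →* GL (Fin 3) R :=
  MonoidHom.toHomUnits
    { toFun p := !![p.1 0 0, p.1 0 1, 0; p.1 1 0, p.1 1 1, 0; 0, 0, (p.2 : R)]
      map_one' := by ext i j; fin_cases i <;> fin_cases j <;> simp
      map_mul' p q := by
        ext i j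
        fin_cases i <;> fin_cases j <;> simp [Matrix.mul_apply, Fin.sum_univ_succ] }

/-- The matrices with a block of size two in the rows and columns `0, 2` and `1` in the middle,
such as `F₀`. -/
def cornerBlockGL : GL (Fin 2) R →* GL (Fin 3) R :=
  MonoidHom.toHomUnits
    { toFun M := !![M 0 0, 0, M 0 1; 0, 1, 0; M 1 0, 0, M 1 1]
      map_one' := by ext i j; fin_cases i <;> fin_cases j <;> simp
      map_mul' p q := by
        ext i j
        fin_cases i <;> fin_cases j <;> simp [Matrix.mul_apply, Fin.sum_univ_succ] }

/-- The diagonal matrices with entries `u, u⁻¹`. -/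
def diagInvGL : Rˣ →* GL (Fin 2) R :=
  MonoidHom.toHomUnits
    { toFun u := !![(u : R), 0; 0, ((u⁻¹ : Rˣ) : R)]
      map_one' := by ext i j; fin_cases i <;> fin_cases j <;> simp
      map_mul' u v := by
        ext i j
        fin_cases i <;> fin_cases j <;> simp [Matrix.mul_apply, mul_comm] }

/-- The diagonal matrices with entries `u, u ^ 2, u ^ 3`, such as `D`. -/
def powersGL : Rˣ →* GL (Fin 3) R :=
  MonoidHom.toHomUnits
    { toFun u := !![(u : R), 0, 0; 0, (u : R) ^ 2, 0; 0, 0, (u : R) ^ 3]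
      map_one' := by ext i j; fin_cases i <;> fin_cases j <;> simp
      map_mul' u v := by
        ext i j
        fin_cases i <;> fin_cases j <;>
          simp [Matrix.mul_apply, Fin.sum_univ_succ, mul_pow] }

theorem coe_upperBlockGL (p : GL (Fin 2) R × Rˣ) : (upperBlockGL p : Matrix (Fin 3) (Fin 3) R) =
    !![p.1 0 0, p.1 0 1, 0; p.1 1 0, p.1 1 1, 0; 0, 0, (p.2 : R)] := rfl

theorem coe_cornerBlockGL (M : GL (Fin 2) R) : (cornerBlockGL M : Matrix (Fin 3) (Fin 3) R) =
    !![M 0 0, 0, M 0 1; 0, 1, 0; M 1 0, 0, M 1 1] := rfl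

theorem coe_diagInvGL (u : Rˣ) :
    (diagInvGL u : Matrix (Fin 2) (Fin 2) R) = !![(u : R), 0; 0, ((u⁻¹ : Rˣ) : R)] := rfl

theorem coe_powersGL (u : Rˣ) : (powersGL u : Matrix (Fin 3) (Fin 3) R) =
    !![(u : R), 0, 0; 0, (u : R) ^ 2, 0; 0, 0, (u : R) ^ 3] := rfl

theorem upperBlockGL_injective : Function.Injective (upperBlockGL (R := R)) := by
  refine (injective_iff_map_eq_one _).2 fun p hp => ?_
  have hval : (upperBlockGL p : Matrix (Fin 3) (Fin 3) R) = 1 := congrArg Units.val hp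
  refine Prod.ext (Units.ext ?_) (Units.ext ?_)
  · ext i j
    have hij := congrFun₂ hval i.castSucc j.castSucc
    fin_cases i <;> fin_cases j <;> simpa [coe_upperBlockGL] using hij
  · simpa [coe_upperBlockGL] using congrFun₂ hval 2 2

theorem map_upperBlockGL (σ : R →+* S) (p : GL (Fin 2) R × Rˣ) :
    Matrix.GeneralLinearGroup.map σ (upperBlockGL p) = upperBlockGL
      ((Matrix.GeneralLinearGroup.map σ).prodMap (Units.map (σ : R →* S)) p) := by
  ext i j
  fin_cases i <;> fin_cases j <;> simp [coe_upperBlockGL]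

theorem map_cornerBlockGL (σ : R →+* S) (M : GL (Fin 2) R) :
    Matrix.GeneralLinearGroup.map σ (cornerBlockGL M) =
      cornerBlockGL (Matrix.GeneralLinearGroup.map σ M) := by
  ext i j
  fin_cases i <;> fin_cases j <;> simp [coe_cornerBlockGL]

theorem map_diagInvGL (σ : R →+* S) (u : Rˣ) :
    Matrix.GeneralLinearGroup.map σ (diagInvGL u) = diagInvGL (Units.map (σ : R →* S) u) := by
  ext i j
  fin_cases i <;> fin_cases j <;> simp [coe_diagInvGL]

theorem commute_cornerBlockGL_upperBlockGL (M : GL (Fin 2) R) (u : Rˣ) :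
    Commute (cornerBlockGL M) (upperBlockGL (diagInvGL u, u)) := by
  ext i j
  rw [Matrix.GeneralLinearGroup.coe_mul, Matrix.GeneralLinearGroup.coe_mul, coe_cornerBlockGL,
    coe_upperBlockGL, coe_diagInvGL]
  fin_cases i <;> fin_cases j <;> simp [Matrix.mul_apply, Fin.sum_univ_succ, mul_comm]

theorem commute_powersGL_upperBlockGL (φ u : Rˣ) :
    Commute (powersGL φ) (upperBlockGL (diagInvGL u, u)) := by
  ext i j
  rw [Matrix.GeneralLinearGroup.coe_mul, Matrix.GeneralLinearGroup.coe_mul, coe_powersGL,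
    coe_upperBlockGL, coe_diagInvGL]
  fin_cases i <;> fin_cases j <;> simp [Matrix.mul_apply, Fin.sum_univ_succ, mul_comm]

theorem commute_upperBlockGL_scalar (M : GL (Fin 2) R) (u v w : Rˣ) : Commute
    (upperBlockGL (M, v)) (upperBlockGL (Matrix.GeneralLinearGroup.scalar (Fin 2) u, w)) := by
  have hscalar : Commute M (Matrix.GeneralLinearGroup.scalar (Fin 2) u) :=
    (Matrix.GeneralLinearGroup.scalar_commute u M).symm
  exact (hscalar.prod (.all v w)).map upperBlockGL

theorem cornerBlockGL_conj_upperBlockGL_zero_two (f : GL (Fin 2) R) (p : GL (Fin 2) R × Rˣ) :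
    (cornerBlockGL f * upperBlockGL p * (cornerBlockGL f)⁻¹ : GL (Fin 3) R) 0 2 =
      f 0 0 * (f⁻¹ : GL (Fin 2) R) 0 1 * (p.1 0 0 - p.2) := by
  have h01 : f 0 0 * (f⁻¹ : GL (Fin 2) R) 0 1 + f 0 1 * (f⁻¹ : GL (Fin 2) R) 1 1 = 0 := by
    simpa [Matrix.mul_apply, -Matrix.coe_units_inv] using congrFun₂ f.mul_inv 0 1
  have hentry : (cornerBlockGL f * upperBlockGL p * (cornerBlockGL f)⁻¹ : GL (Fin 3) R) 0 2 =
      f 0 0 * p.1 0 0 * (f⁻¹ : GL (Fin 2) R) 0 1 + f 0 1 * p.2 * (f⁻¹ : GL (Fin 2) R) 1 1 := by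
    rw [← map_inv, Matrix.GeneralLinearGroup.coe_mul, Matrix.GeneralLinearGroup.coe_mul,
      coe_cornerBlockGL, coe_cornerBlockGL, coe_upperBlockGL]
    simp [Matrix.mul_apply, Fin.sum_univ_succ, -Matrix.coe_units_inv]
  rw [hentry]
  linear_combination (p.2 : R) * h01

theorem cornerBlockGL_conj_upperBlockGL_two_zero (f : GL (Fin 2) R) (p : GL (Fin 2) R × Rˣ) :
    (cornerBlockGL f * upperBlockGL p * (cornerBlockGL f)⁻¹ : GL (Fin 3) R) 2 0 =
      f 1 1 * (f⁻¹ : GL (Fin 2) R) 1 0 * (p.2 - p.1 0 0) := by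
  have h10 : f 1 0 * (f⁻¹ : GL (Fin 2) R) 0 0 + f 1 1 * (f⁻¹ : GL (Fin 2) R) 1 0 = 0 := by
    simpa [Matrix.mul_apply, -Matrix.coe_units_inv] using congrFun₂ f.mul_inv 1 0
  have hentry : (cornerBlockGL f * upperBlockGL p * (cornerBlockGL f)⁻¹ : GL (Fin 3) R) 2 0 =
      f 1 0 * p.1 0 0 * (f⁻¹ : GL (Fin 2) R) 0 0 + f 1 1 * p.2 * (f⁻¹ : GL (Fin 2) R) 1 0 := by
    rw [← map_inv, Matrix.GeneralLinearGroup.coe_mul, Matrix.GeneralLinearGroup.coe_mul,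
      coe_cornerBlockGL, coe_cornerBlockGL, coe_upperBlockGL]
    simp [Matrix.mul_apply, Fin.sum_univ_succ, -Matrix.coe_units_inv]
  rw [hentry]
  linear_combination (p.1 0 0 : R) * h10

open Polynomial

theorem hasLeadingTerm_powersGL_conj [Algebra R S] (φ : Sˣ) (M : GL (Fin 2) R) :
    HasLeadingTerm (φ : S) 2 ((powersGL φ * cornerBlockGL
      (Matrix.GeneralLinearGroup.map (algebraMap R S) M) * (powersGL φ)⁻¹ : GL (Fin 3) S) :
        Matrix (Fin 3) (Fin 3) S) (Matrix.single 0 2 (M 0 1)) := by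
  refine ⟨!![X ^ 2 * C (M 0 0), 0, C (M 0 1); 0, X ^ 2, 0; X ^ 4 * C (M 1 0), 0,
    X ^ 2 * C (M 1 1)], ?_, by ext i j; fin_cases i <;> fin_cases j <;> simp⟩
  rw [Units.val_mul, ← smul_mul_assoc, Units.mul_inv_eq_iff_eq_mul, Units.val_mul, coe_powersGL,
    coe_cornerBlockGL]
  ext i j
  fin_cases i <;> fin_cases j <;> simp [Matrix.mul_apply, Fin.sum_univ_succ] <;> grind

theorem hasLeadingTerm_powersGL_inv_conj [Algebra R S] (φ : Sˣ) (M : GL (Fin 2) R) :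
    HasLeadingTerm (φ : S) 2 (((powersGL φ)⁻¹ * cornerBlockGL
      (Matrix.GeneralLinearGroup.map (algebraMap R S) M) * powersGL φ : GL (Fin 3) S) :
        Matrix (Fin 3) (Fin 3) S) (Matrix.single 2 0 (M 1 0)) := by
  refine ⟨!![X ^ 2 * C (M 0 0), 0, X ^ 4 * C (M 0 1); 0, X ^ 2, 0; C (M 1 0), 0,
    X ^ 2 * C (M 1 1)], ?_, by ext i j; fin_cases i <;> fin_cases j <;> simp⟩
  rw [mul_assoc, Units.val_mul, ← mul_smul_comm, Units.inv_mul_eq_iff_eq_mul, Units.val_mul,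
    coe_powersGL, coe_cornerBlockGL]
  ext i j
  fin_cases i <;> fin_cases j <;> simp [Matrix.mul_apply, Fin.sum_univ_succ] <;>
    grind [Algebra.smul_def]

end BlockMatrices

section PathRepresentation

open FreeGroup (of)
open Multiplicative

variable {ι H R S : Type*} [Group H] [CommRing R] [CommRing S]

theorem prod_freeGroup_hom_ext {φ ψ : Multiplicative ℤ × FreeGroup ι →* H}
    (h₁ : φ (ofAdd 1, 1) = ψ (ofAdd 1, 1)) (h₂ : ∀ i, φ (1, of i) = ψ (1, of i)) : φ = ψ := by
  have hinl : φ.comp (.inl _ _) = ψ.comp (.inl _ _) := MonoidHom.ext_mint h₁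
  have hinr : φ.comp (.inr _ _) = ψ.comp (.inr _ _) := FreeGroup.ext_hom _ _ h₂
  ext p
  have hp : p = (p.1, 1) * (1, p.2) := by simp
  rw [hp, map_mul, map_mul]
  exact congrArg₂ (· * ·) (DFunLike.congr_fun hinl p.1) (DFunLike.congr_fun hinr p.2)

/-- The homomorphism from `⟨Q⟩ × ⟨G, P⟩`, the right angled Artin group of the star of the vertex
`Q`, to the right angled Artin group of the path `G - Q - P - F`. -/
def pathStarHom : Multiplicative ℤ × FreeGroup (Fin 2) →* RAAG (SimpleGraph.pathGraph 4) :=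
  (zpowersHom _ (RAAG.gen _ 1)).noncommCoprod (FreeGroup.lift ![RAAG.gen _ 0, RAAG.gen _ 2])
    fun k w => by
      have h10 : Commute (RAAG.gen (SimpleGraph.pathGraph 4) 1) (RAAG.gen _ 0) :=
        RAAG.commute_gen (by simp [SimpleGraph.pathGraph_adj])
      have h12 : Commute (RAAG.gen (SimpleGraph.pathGraph 4) 1) (RAAG.gen _ 2) :=
        RAAG.commute_gen (by simp [SimpleGraph.pathGraph_adj])
      refine commute_freeGroup_lift (fun i => ?_) w
      fin_cases i
      · exact h10.zpow_left k.toAdd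
      · exact h12.zpow_left k.toAdd

theorem pathStarHom_mk_one (k : Multiplicative ℤ) :
    pathStarHom (k, 1) = RAAG.gen _ 1 ^ k.toAdd := by
  simp [pathStarHom]

theorem pathStarHom_one_mk (w : FreeGroup (Fin 2)) :
    pathStarHom (1, w) = FreeGroup.lift ![RAAG.gen _ 0, RAAG.gen _ 2] w := by
  simp [pathStarHom]

theorem gen_mem_range_pathStarHom {v : Fin 4} (hv : v ≠ 3) :
    RAAG.gen _ v ∈ pathStarHom.range := by
  fin_cases v
  · exact ⟨(1, of 0), by simp [pathStarHom_one_mk]⟩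
  · exact ⟨(ofAdd 1, 1), by simp [pathStarHom_mk_one]⟩
  · exact ⟨(1, of 1), by simp [pathStarHom_one_mk]⟩
  · exact absurd rfl hv

theorem hasAlternatingForm_pathGraph (x : RAAG (SimpleGraph.pathGraph 4)) :
    HasAlternatingForm pathStarHom.range (Subgroup.zpowers (RAAG.gen _ 2)) (RAAG.gen _ 3) x := by
  refine hasAlternatingForm_of_closure_eq_top ?_ ?_ x
  · rintro _ ⟨n, rfl⟩
    exact (RAAG.commute_gen (by simp [SimpleGraph.pathGraph_adj])).zpow_right n
  · refine top_unique ((RAAG.closure_range_gen _).ge.trans (Subgroup.closure_mono ?_))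
    rintro _ ⟨v, rfl⟩
    rcases eq_or_ne v 3 with rfl | hv
    · exact .inl rfl
    · exact .inr (gen_mem_range_pathStarHom hv)

/-- The blocks of sizes two and one of the images of `⟨Q⟩ × ⟨G, P⟩` under `Q ↦ Q₀`, `G ↦ G₀` and
`P ↦ P₀`, where `g` is the block of size two of `G₀` and `u = λ`. -/
def starBlocks (g : GL (Fin 2) R) (u : Rˣ) :
    Multiplicative ℤ × FreeGroup (Fin 2) →* GL (Fin 2) R × Rˣ where
  toFun p := (Matrix.GeneralLinearGroup.scalar (Fin 2) (u ^ p.1.toAdd) *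
    FreeGroup.lift ![g, diagInvGL u] p.2, u ^ ((exponentSum 1 p.2).toAdd - p.1.toAdd))
  map_one' := by simp
  map_mul' p q := by
    refine Prod.ext ?_ ?_
    · have hcomm := Matrix.GeneralLinearGroup.scalar_commute (u ^ q.1.toAdd)
        (FreeGroup.lift ![g, diagInvGL u] p.2)
      simp only [Prod.fst_mul, Prod.snd_mul, toAdd_mul, zpow_add, map_mul]
      exact Commute.mul_mul_mul_comm hcomm _ _
    · simp only [Prod.fst_mul, Prod.snd_mul, map_mul, toAdd_mul, ← zpow_add]
      congr 1
      ring

theorem starBlocks_apply (g : GL (Fin 2) R) (u : Rˣ) (p : Multiplicative ℤ × FreeGroup (Fin 2)) :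
    starBlocks g u p = (Matrix.GeneralLinearGroup.scalar (Fin 2) (u ^ p.1.toAdd) *
      FreeGroup.lift ![g, diagInvGL u] p.2, u ^ ((exponentSum 1 p.2).toAdd - p.1.toAdd)) :=
  rfl

theorem starBlocks_ofAdd_one (g : GL (Fin 2) R) (u : Rˣ) :
    starBlocks g u (ofAdd 1, 1) = (Matrix.GeneralLinearGroup.scalar (Fin 2) u, u⁻¹) := by
  simp [starBlocks_apply]

theorem starBlocks_of_zero (g : GL (Fin 2) R) (u : Rˣ) : starBlocks g u (1, of 0) = (g, 1) := by
  simp [starBlocks_apply, exponentSum]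

theorem starBlocks_of_one (g : GL (Fin 2) R) (u : Rˣ) :
    starBlocks g u (1, of 1) = (diagInvGL u, u) := by
  simp [starBlocks_apply, exponentSum]

theorem map_starBlocks (σ : R →+* S) (g : GL (Fin 2) R) (u : Rˣ)
    (p : Multiplicative ℤ × FreeGroup (Fin 2)) :
    (Matrix.GeneralLinearGroup.map σ).prodMap (Units.map (σ : R →* S)) (starBlocks g u p) =
      starBlocks (Matrix.GeneralLinearGroup.map σ g) (Units.map (σ : R →* S) u) p := by
  refine DFunLike.congr_fun (f := MonoidHom.comp
      ((Matrix.GeneralLinearGroup.map σ).prodMap (Units.map (σ : R →* S))) (starBlocks g u))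
    (prod_freeGroup_hom_ext ?_ fun i => ?_) p
  · rw [MonoidHom.comp_apply, starBlocks_ofAdd_one, starBlocks_ofAdd_one]
    exact Prod.ext (Matrix.GeneralLinearGroup.map_scalar σ u)
      (map_inv (Units.map (σ : R →* S)) u)
  · fin_cases i
    · simp [starBlocks_of_zero]
    · simp [starBlocks_of_one, map_diagInvGL]

theorem exists_eq_of_one_zpow_of_starBlocks {g : GL (Fin 2) R} {u : Rˣ}
    (hone : ∀ w, FreeGroup.lift ![g, diagInvGL u] w 0 0 = 1 → w = 1)
    {p : Multiplicative ℤ × FreeGroup (Fin 2)}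
    (hp : (starBlocks g u p).1 0 0 = (starBlocks g u p).2) : ∃ n : ℤ, p = (1, of 1 ^ n) := by
  obtain ⟨k, w⟩ := p
  set e := (exponentSum 1 w).toAdd
  have hentry : ((u ^ k.toAdd : Rˣ) : R) * FreeGroup.lift ![g, diagInvGL u] w 0 0 =
      ((u ^ (e - k.toAdd) : Rˣ) : R) := by
    simpa only [starBlocks_apply, Matrix.GeneralLinearGroup.coe_mul,
      Matrix.GeneralLinearGroup.coe_scalar, Matrix.scalar_apply, Matrix.diagonal_mul] using hp
  have hw : of 1 ^ (2 * k.toAdd - e) * w = 1 := hone _ <| by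
    have hpow : FreeGroup.lift ![g, diagInvGL u] (of 1 ^ (2 * k.toAdd - e)) =
        diagInvGL (u ^ (2 * k.toAdd - e)) := by simp
    rw [map_mul, hpow, Matrix.GeneralLinearGroup.coe_mul, coe_diagInvGL,
      show 2 * k.toAdd - e = k.toAdd - e + k.toAdd by ring, zpow_add]
    simp only [Matrix.mul_apply, Fin.sum_univ_two, Matrix.of_apply, Matrix.cons_val',
      Matrix.cons_val_zero, Matrix.cons_val_one, Matrix.cons_val_fin_one, zero_mul, add_zero,
      Units.val_mul, mul_assoc, hentry]
    rw [← Units.val_mul, ← zpow_add, sub_add_sub_cancel', sub_self, zpow_zero, Units.val_one]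
  have hw' : w = of 1 ^ (e - 2 * k.toAdd) := by
    rw [← neg_sub, zpow_neg]
    exact eq_inv_of_mul_eq_one_right hw
  have he : e = e - 2 * k.toAdd := by
    conv_lhs => rw [show e = (exponentSum 1 w).toAdd from rfl, hw', exponentSum_of_zpow,
      toAdd_ofAdd]
  have hk : k = 1 := toAdd_eq_zero.1 (by omega)
  exact ⟨_, Prod.ext hk hw'⟩

/-- The representation of the theorem; `g` and `f` are the blocks of size two of `G₀` and `F₀`,
`u = λ`, and conjugation by `powersGL φ` is conjugation by `D`. -/
def pathRep (g f : GL (Fin 2) R) (u φ : Rˣ) : RAAG (SimpleGraph.pathGraph 4) →* GL (Fin 3) R :=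
  RAAG.lift
    ![cornerBlockGL f * upperBlockGL (g, 1) * (cornerBlockGL f)⁻¹,
      cornerBlockGL f * upperBlockGL (Matrix.GeneralLinearGroup.scalar (Fin 2) u, u⁻¹) *
        (cornerBlockGL f)⁻¹,
      upperBlockGL (diagInvGL u, u),
      powersGL φ * cornerBlockGL f * (powersGL φ)⁻¹] fun _ _ => by
    have hf := commute_cornerBlockGL_upperBlockGL f u
    have hφ := commute_powersGL_upperBlockGL φ u
    refine commute_of_pathGraph_adj fun i => ?_
    fin_cases i
    · exact (commute_upperBlockGL_scalar g u 1 u⁻¹).conj _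
    · exact ((hf.mul_left (commute_upperBlockGL_scalar _ u u u⁻¹).symm).mul_left hf.inv_left)
    · exact ((hφ.mul_left hf).mul_left hφ.inv_left).symm

theorem pathRep_gen (g f : GL (Fin 2) R) (u φ : Rˣ) (v : Fin 4) :
    pathRep g f u φ (RAAG.gen _ v) =
      ![cornerBlockGL f * upperBlockGL (g, 1) * (cornerBlockGL f)⁻¹,
        cornerBlockGL f * upperBlockGL (Matrix.GeneralLinearGroup.scalar (Fin 2) u, u⁻¹) *
          (cornerBlockGL f)⁻¹,
        upperBlockGL (diagInvGL u, u),
        powersGL φ * cornerBlockGL f * (powersGL φ)⁻¹] v :=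
  RAAG.lift_gen _ _ v

theorem pathRep_pathStarHom (g f : GL (Fin 2) R) (u φ : Rˣ)
    (p : Multiplicative ℤ × FreeGroup (Fin 2)) :
    pathRep g f u φ (pathStarHom p) =
      cornerBlockGL f * upperBlockGL (starBlocks g u p) * (cornerBlockGL f)⁻¹ := by
  refine DFunLike.congr_fun (f := (pathRep g f u φ).comp pathStarHom)
    (g := (MulAut.conj (cornerBlockGL f)).toMonoidHom.comp (upperBlockGL.comp (starBlocks g u)))
    (prod_freeGroup_hom_ext ?_ fun i => ?_) p
  · simp [pathStarHom_mk_one, pathRep_gen, starBlocks_ofAdd_one]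
  · fin_cases i
    · simp [pathStarHom_one_mk, pathRep_gen, starBlocks_of_zero]
    · simp [pathStarHom_one_mk, pathRep_gen, starBlocks_of_one,
        (commute_cornerBlockGL_upperBlockGL f u).eq]

theorem pathRep_gen_three_zpow (g f : GL (Fin 2) R) (u φ : Rˣ) (m : ℤ) :
    pathRep g f u φ (RAAG.gen _ 3 ^ m) =
      powersGL φ * cornerBlockGL (f ^ m) * (powersGL φ)⁻¹ := by
  rw [map_zpow, map_zpow, ← conj_zpow, pathRep_gen]
  rfl

theorem eq_one_of_mem_zpowers_gen_two {g f : GL (Fin 2) R} {u φ : Rˣ}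
    (hone : ∀ w, FreeGroup.lift ![g, diagInvGL u] w 0 0 = 1 → w = 1)
    {x : RAAG (SimpleGraph.pathGraph 4)} (hx : x ∈ Subgroup.zpowers (RAAG.gen _ 2))
    (h : pathRep g f u φ x = 1) : x = 1 := by
  obtain ⟨n, rfl⟩ := hx
  have hdiag : diagInvGL u ^ n = 1 := by
    have hupper : upperBlockGL ((diagInvGL u, u) ^ n) = 1 := by
      simpa [pathRep_gen, -Prod.pow_mk] using h
    exact congrArg Prod.fst ((map_eq_one_iff _ upperBlockGL_injective).1 hupper)
  have hw : (of 1 : FreeGroup (Fin 2)) ^ n = 1 := hone _ (by simp [hdiag])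
  simpa using congrArg (FreeGroup.lift ![RAAG.gen (SimpleGraph.pathGraph 4) 0, RAAG.gen _ 2]) hw

theorem exists_map_eq_pathRep (σ : R →+* S) {g f : GL (Fin 2) R} {u : Rˣ} (φ : Sˣ)
    (hone : ∀ w, FreeGroup.lift ![Matrix.GeneralLinearGroup.map σ g,
      diagInvGL (Units.map (σ : R →* S) u)] w 0 0 = 1 → w = 1) {i j : Fin 3}
    (hentry : ∀ p : GL (Fin 2) R × Rˣ, p.1 0 0 ≠ (p.2 : R) →
      (cornerBlockGL f * upperBlockGL p * (cornerBlockGL f)⁻¹ : GL (Fin 3) R) i j ≠ 0) :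
    ∀ x ∈ pathStarHom.range, ∃ M : GL (Fin 3) R,
      Matrix.GeneralLinearGroup.map σ M = pathRep (Matrix.GeneralLinearGroup.map σ g)
        (Matrix.GeneralLinearGroup.map σ f) (Units.map (σ : R →* S) u) φ x ∧
      (x ∉ Subgroup.zpowers (RAAG.gen _ 2) → M i j ≠ 0) := by
  rintro _ ⟨p, rfl⟩
  refine ⟨cornerBlockGL f * upperBlockGL (starBlocks g u p) * (cornerBlockGL f)⁻¹, ?_,
    fun hp => hentry _ fun h => hp ?_⟩
  · rw [pathRep_pathStarHom, map_mul, map_mul, map_inv, map_cornerBlockGL, map_upperBlockGL,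
      map_starBlocks]
  · obtain ⟨n, rfl⟩ := exists_eq_of_one_zpow_of_starBlocks hone (p := p) (by
      rw [← map_starBlocks]
      exact congrArg σ h)
    exact ⟨n, by simp [pathStarHom_one_mk]⟩

theorem transcendental_units_inv {K L : Type*} [CommRing K] [CommRing L] [Algebra K L] {φ : Lˣ}
    (hφ : Transcendental K (φ : L)) : Transcendental K ((φ⁻¹ : Lˣ) : L) := fun h => hφ <| by
  let _ : Invertible (φ : L) := φ.invertible
  exact IsAlgebraic.invOf_iff.1 (by rwa [invOf_units])

section Faithfulness

variable {K L : Type*} [CommRing K] [NoZeroDivisors K] [CommRing L] [Algebra K L] {φ : Lˣ}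

theorem pathRep_map_injective_of_zero_zero_ne {g f : GL (Fin 2) K} {u : Kˣ}
    (hφ : Transcendental K (φ : L)) (hf₀₀ : f 0 0 ≠ 0) (hf₀₁ : (f⁻¹ : GL (Fin 2) K) 0 1 ≠ 0)
    (hf₁₀ : ∀ n : ℤ, n ≠ 0 → (f ^ n : GL (Fin 2) K) 1 0 ≠ 0)
    (hone : ∀ w, FreeGroup.lift ![Matrix.GeneralLinearGroup.map (algebraMap K L) g,
      diagInvGL (Units.map (algebraMap K L : K →* L) u)] w 0 0 = 1 → w = 1) :
    Function.Injective (pathRep (Matrix.GeneralLinearGroup.map (algebraMap K L) g)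
      (Matrix.GeneralLinearGroup.map (algebraMap K L) f)
      (Units.map (algebraMap K L : K →* L) u) φ) := by
  refine injective_of_hasLeadingTerm (transcendental_units_inv hφ) (i := 2) (j := 0) (by decide)
    two_ne_zero hasAlternatingForm_pathGraph
    (fun x hx => eq_one_of_mem_zpowers_gen_two hone hx)
    (exists_map_eq_pathRep (algebraMap K L) φ hone fun p hp => ?_) fun m hm => ⟨_, hf₁₀ m hm, ?_⟩
  · rw [cornerBlockGL_conj_upperBlockGL_zero_two]
    exact mul_ne_zero (mul_ne_zero hf₀₀ hf₀₁) (sub_ne_zero.2 hp)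
  · rw [pathRep_gen_three_zpow, ← map_zpow]
    simpa only [map_inv, inv_inv] using hasLeadingTerm_powersGL_inv_conj φ⁻¹ (f ^ m)

theorem pathRep_map_injective_of_one_one_ne {g f : GL (Fin 2) K} {u : Kˣ}
    (hφ : Transcendental K (φ : L)) (hf₁₁ : f 1 1 ≠ 0) (hf₁₀ : (f⁻¹ : GL (Fin 2) K) 1 0 ≠ 0)
    (hf₀₁ : ∀ n : ℤ, n ≠ 0 → (f ^ n : GL (Fin 2) K) 0 1 ≠ 0)
    (hone : ∀ w, FreeGroup.lift ![Matrix.GeneralLinearGroup.map (algebraMap K L) g,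
      diagInvGL (Units.map (algebraMap K L : K →* L) u)] w 0 0 = 1 → w = 1) :
    Function.Injective (pathRep (Matrix.GeneralLinearGroup.map (algebraMap K L) g)
      (Matrix.GeneralLinearGroup.map (algebraMap K L) f)
      (Units.map (algebraMap K L : K →* L) u) φ) := by
  refine injective_of_hasLeadingTerm hφ (i := 0) (j := 2) (by decide)
    two_ne_zero hasAlternatingForm_pathGraph
    (fun x hx => eq_one_of_mem_zpowers_gen_two hone hx)
    (exists_map_eq_pathRep (algebraMap K L) φ hone fun p hp => ?_) fun m hm => ⟨_, hf₀₁ m hm, ?_⟩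
  · rw [cornerBlockGL_conj_upperBlockGL_two_zero]
    exact mul_ne_zero (mul_ne_zero hf₁₁ hf₁₀) (sub_ne_zero.2 hp.symm)
  · rw [pathRep_gen_three_zpow, ← map_zpow]
    exact hasLeadingTerm_powersGL_conj φ (f ^ m)

theorem zero_zero_ne_zero_or_one_one_ne_zero {f : GL (Fin 2) R}
    (hf : (f ^ (2 : ℤ) : GL (Fin 2) R) 0 1 ≠ 0) : f 0 0 ≠ 0 ∨ f 1 1 ≠ 0 := by
  contrapose! hf
  rw [zpow_two, Matrix.GeneralLinearGroup.coe_mul]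
  simp [Matrix.mul_apply, hf.1, hf.2]

theorem pathRep_injective {g f : GL (Fin 2) L} {u : Lˣ} (hφ : Transcendental K (φ : L))
    (hg : g ∈ (Matrix.GeneralLinearGroup.map (algebraMap K L)).range)
    (hf : f ∈ (Matrix.GeneralLinearGroup.map (algebraMap K L)).range)
    (hu : u ∈ (Units.map (algebraMap K L : K →* L)).range)
    (hoff : ∀ n : ℤ, n ≠ 0 →
      (f ^ n : GL (Fin 2) L) 0 1 ≠ 0 ∧ (f ^ n : GL (Fin 2) L) 1 0 ≠ 0)
    (hone : ∀ w, FreeGroup.lift ![g, diagInvGL u] w 0 0 = 1 → w = 1) :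
    Function.Injective (pathRep g f u φ) := by
  obtain ⟨g, rfl⟩ := hg
  obtain ⟨f, rfl⟩ := hf
  obtain ⟨u, rfl⟩ := hu
  replace hoff (n : ℤ) (hn : n ≠ 0) :
      (f ^ n : GL (Fin 2) K) 0 1 ≠ 0 ∧ (f ^ n : GL (Fin 2) K) 1 0 ≠ 0 := by
    simp only [← map_zpow, Matrix.GeneralLinearGroup.map_apply] at hoff
    exact (hoff n hn).imp ne_zero_of_map ne_zero_of_map
  have hinv := hoff (-1) (by decide)
  rw [zpow_neg_one] at hinv
  rcases zero_zero_ne_zero_or_one_one_ne_zero (hoff 2 two_ne_zero).1 with h | h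
  · exact pathRep_map_injective_of_zero_zero_ne hφ h hinv.1 (fun n hn => (hoff n hn).2) hone
  · exact pathRep_map_injective_of_one_one_ne hφ h hinv.2 (fun n hn => (hoff n hn).1) hone

end Faithfulness

end PathRepresentation

section Fields

variable {F : Type*} [Field F]

theorem gl2Diag_eq_diagInvGL (lam : F) (h : lam ≠ 0) :
    gl2Diag lam h = diagInvGL (Units.mk0 lam h) :=
  Units.ext rfl

theorem gl2_mem_range_map {k : Type*} [Field k] [Algebra k F] (K : IntermediateField k F)
    {a b c d : F} (h : a * d - b * c ≠ 0) (ha : a ∈ K) (hb : b ∈ K) (hc : c ∈ K) (hd : d ∈ K) :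
    gl2 a b c d h ∈ (Matrix.GeneralLinearGroup.map (algebraMap K F)).range := by
  refine ⟨gl2 ⟨a, ha⟩ ⟨b, hb⟩ ⟨c, hc⟩ ⟨d, hd⟩ fun h0 => h (congrArg (algebraMap K F) h0), ?_⟩
  ext i j
  fin_cases i <;> fin_cases j <;> rfl

theorem units_mk0_mem_range_map {k : Type*} [Field k] [Algebra k F] (K : IntermediateField k F)
    {x : F} (h : x ≠ 0) (hx : x ∈ K) :
    Units.mk0 x h ∈ (Units.map (algebraMap K F : K →* F)).range :=
  ⟨Units.mk0 ⟨x, hx⟩ fun h0 => h (congrArg (algebraMap K F) h0), Units.ext rfl⟩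

theorem matF₀_eq_cornerBlockGL {α β γ δ : F} (h : α * δ - β * γ ≠ 0) :
    matF₀ α β γ δ = cornerBlockGL (gl2 α β γ δ h) := rfl

theorem matG₀_eq_upperBlockGL {a b c d : F} (h : a * d - b * c ≠ 0) :
    matG₀ a b c d = upperBlockGL (gl2 a b c d h, 1) := rfl

theorem matQ₀_eq_upperBlockGL {lam : F} (h : lam ≠ 0) :
    matQ₀ lam = upperBlockGL (Matrix.GeneralLinearGroup.scalar (Fin 2) (Units.mk0 lam h),
      (Units.mk0 lam h)⁻¹) := by
  simp [matQ₀, coe_upperBlockGL]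

theorem matP₀_eq_upperBlockGL {lam : F} (h : lam ≠ 0) :
    matP₀ lam = upperBlockGL (diagInvGL (Units.mk0 lam h), Units.mk0 lam h) := rfl

theorem matD_eq_powersGL {φ : F} (h : φ ≠ 0) : matD φ = powersGL (Units.mk0 φ h) := rfl

end Fields

/-- The vertices `0, 1, 2, 3` of the path carry the labels `G, Q, P, F`. The determinants of the
matrices that are inverted are nonzero: `φ ≠ 0` because `φ` is transcendental. -/
theorem mainTheorem7 {F : Type*} [Field F] (a b c d α β γ δ lam φ : F)
    (hG : a * d - b * c ≠ 0) (hF : α * δ - β * γ ≠ 0) (hlam : lam ≠ 0)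
    (h1 : ∀ n : ℤ, n ≠ 0 →
      (gl2 α β γ δ hF ^ n : GL (Fin 2) F) 0 1 ≠ 0 ∧ (gl2 α β γ δ hF ^ n : GL (Fin 2) F) 1 0 ≠ 0)
    (h2free : IsNonabelianFree (Subgroup.closure {gl2 a b c d hG, gl2Diag lam hlam}))
    (h2one : ∀ M ∈ Subgroup.closure {gl2 a b c d hG, gl2Diag lam hlam}, M 0 0 = 1 → M = 1)
    (hφ : Transcendental
      (IntermediateField.adjoin (⊥ : Subfield F) ({a, b, c, d, α, β, γ, δ, lam} : Set F)) φ) :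
    matF₀ α β γ δ * matP₀ lam * (matF₀ α β γ δ)⁻¹ = matP₀ lam ∧
    matD φ * matP₀ lam * (matD φ)⁻¹ = matP₀ lam ∧
    ∃ ρ : RAAG (SimpleGraph.pathGraph 4) →* GL (Fin 3) F,
      (ρ (RAAG.gen _ 0) : Matrix (Fin 3) (Fin 3) F) =
        matF₀ α β γ δ * matG₀ a b c d * (matF₀ α β γ δ)⁻¹ ∧
      (ρ (RAAG.gen _ 1) : Matrix (Fin 3) (Fin 3) F) =
        matF₀ α β γ δ * matQ₀ lam * (matF₀ α β γ δ)⁻¹ ∧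
      (ρ (RAAG.gen _ 2) : Matrix (Fin 3) (Fin 3) F) =
        matD φ * matP₀ lam * (matD φ)⁻¹ ∧
      (ρ (RAAG.gen _ 3) : Matrix (Fin 3) (Fin 3) F) =
        matD φ * matF₀ α β γ δ * (matD φ)⁻¹ ∧
      Function.Injective ρ := by
  have hφ₀ : φ ≠ 0 := fun h => hφ (h ▸ isAlgebraic_zero)
  set S : Set F := {a, b, c, d, α, β, γ, δ, lam} with hS
  let K := IntermediateField.adjoin (⊥ : Subfield F) S
  have hK : S ⊆ K := IntermediateField.subset_adjoin _ S
  simp only [hS, Set.insert_subset_iff, Set.singleton_subset_iff, SetLike.mem_coe] at hK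
  obtain ⟨ha, hb, hc, hd, hα, hβ, hγ, hδ, hl⟩ := hK
  set g := gl2 a b c d hG
  set f := gl2 α β γ δ hF
  let u := Units.mk0 lam hlam
  let v := Units.mk0 φ hφ₀
  have hPF : cornerBlockGL f * upperBlockGL (diagInvGL u, u) * (cornerBlockGL f)⁻¹ = _ :=
    (commute_cornerBlockGL_upperBlockGL f u).mul_inv_cancel
  have hPD : powersGL v * upperBlockGL (diagInvGL u, u) * (powersGL v)⁻¹ = _ :=
    (commute_powersGL_upperBlockGL v u).mul_inv_cancel
  have hone (w : FreeGroup (Fin 2)) (hw : FreeGroup.lift ![g, diagInvGL u] w 0 0 = 1) : w = 1 := by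
    rw [gl2Diag_eq_diagInvGL] at h2free h2one
    rw [← range_freeGroup_lift_pair] at h2one
    exact (map_eq_one_iff _ h2free.lift_injective).1 (h2one _ ⟨w, rfl⟩ hw)
  rw [matF₀_eq_cornerBlockGL hF, matG₀_eq_upperBlockGL hG, matQ₀_eq_upperBlockGL hlam,
    matP₀_eq_upperBlockGL hlam, matD_eq_powersGL hφ₀]
  simp only [← Matrix.GeneralLinearGroup.coe_inv, ← Matrix.GeneralLinearGroup.coe_mul,
    Units.val_inj]
  exact ⟨hPF, hPD, pathRep g f u v, pathRep_gen _ _ _ _ 0, pathRep_gen _ _ _ _ 1,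
    (pathRep_gen _ _ _ _ 2).trans hPD.symm, pathRep_gen _ _ _ _ 3,
    pathRep_injective (K := K) hφ (gl2_mem_range_map K hG ha hb hc hd)
      (gl2_mem_range_map K hF hα hβ hγ hδ) (units_mk0_mem_range_map K hlam hl) h1 hone⟩
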